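/- Fix an integer $d\ge 0$. A free set $\mathcal S=\bigsqcup_{n\ge 1}\mathcal S_n$ is a family of sets $\mathcal S_n\subseteq M_n(\mathbb C)^d$, $n\ge 1$. It is matrix convex if $X\oplus Y\in\mathcal S_{m+n}$ for all $X\in\mathcal S_m$, $Y\in\mathcal S_n$, and $(\phi(X_1),\dots,\phi(X_d))\in\mathcal S_k$ for every $X\in\mathcal S_m$ and every unital completely positive map $\phi:M_m(\mathbb C)\to M_k(\mathbb C)$. It is closed (bounded) if every level $\mathcal S_n$ is closed (bounded). The first level $\mathcal S_1$ is regarded as a subset of $\mathbb C^d$. Let $X\in\mathcal S_n$. A weakly proper matrix convex combination representing $X$ is an expression $X=\sum_{i=1}^k V_i^*X^{(i)}V_i$ with $X^{(i)}\in\mathcal S_{n_i}$, $V_i\in M_{n_i,n}(\mathbb C)$, $V_i\ne 0$ and $\sum_{i=1}^k V_i^*V_i=I_n$. The point $X$ is an absolute extreme point of $\mathcal S$ if, for every such expression and every $i$, the tuple $X^{(i)}$ is unitarily equivalent to $X$ or to $X\oplus Z_i$ for some $Z_i\in\mathcal S$. A polytope in $\mathbb C^d\cong\mathbb R^{2d}$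 is the (real) convex hull of finitely many points, and its vertices are its extreme points. An isolated extreme point of a set $K\subseteq\mathbb C^d$ is an extreme point of $K$ that is isolated in the set of all extreme points of $K$. **Proposition 2.1.** Let $\mathcal S$ be a closed and bounded matrix convex set with $\mathcal S_1=K$. If $\lambda\in K$ and there is a polytope $P$ such that $K\subseteq P$ and $\lambda$ is a vertex of $P$, then $\lambda$ is an absolute extreme point of $\mathcal S$. Consequently, if $\lambda$ is an isolated extreme point of $K$, then $\lambda$ is an absolute extreme point of $\mathcal S$. -/

import Mathlib

namespace MatrixConvexity

/-- `d`-tuples of `n × n` complex matrices. -/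
abbrev MatTuple (d n : ℕ) : Type := Fin d → Matrix (Fin n) (Fin n) ℂ

/-- A free set `⊔ₙ Sₙ`, given by its levels `S n ⊆ Mₙ(ℂ)ᵈ`.  Only the levels `n ≥ 1` are meaningful;
every notion below ignores the level `n = 0`. -/
abbrev FreeSet (d : ℕ) : Type := (n : ℕ) → Set (MatTuple d n)

/-- The direct sum `X ⊕ Y` of two tuples, of size `m + n`. -/
def directSum {d m n : ℕ} (X : MatTuple d m) (Y : MatTuple d n) : MatTuple d (m + n) :=
  fun j => Matrix.reindex finSumFinEquiv finSumFinEquiv (Matrix.fromBlocks (X j) 0 0 (Y j))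

/-- The tuple `V* X V`. -/
def conjBy {d n m : ℕ} (V : Matrix (Fin n) (Fin m) ℂ) (X : MatTuple d n) : MatTuple d m :=
  fun j => V.conjTranspose * X j * V

/-- Unitary equivalence of tuples: `Y = U* X U` for a unitary `U`.  The sizes `m` and `n` are
allowed to be different as expressions; the two unitarity conditions force `m = n`. -/
def UnitarilyEquivalent {d m n : ℕ} (X : MatTuple d m) (Y : MatTuple d n) : Prop :=
  ∃ U : Matrix (Fin m) (Fin n) ℂ,
    U.conjTranspose * U = 1 ∧ U * U.conjTranspose = 1 ∧ Y = conjBy U X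

section CStar

open scoped Matrix.Norms.L2Operator MatrixOrder CStarAlgebra

/-- A free set is matrix convex if it is closed under direct sums and under the (entrywise)
application of unital completely positive maps `M_m(ℂ) → M_k(ℂ)`. -/
def IsMatrixConvex {d : ℕ} (S : FreeSet d) : Prop :=
  (∀ m n : ℕ, 0 < m → 0 < n → ∀ X ∈ S m, ∀ Y ∈ S n, directSum X Y ∈ S (m + n)) ∧
  (∀ m k : ℕ, 0 < m → 0 < k →
    ∀ φ : Matrix (Fin m) (Fin m) ℂ →CP Matrix (Fin k) (Fin k) ℂ, φ 1 = 1 →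
      ∀ X ∈ S m, (fun j => φ (X j)) ∈ S k)

/-- Every level is closed. -/
def IsLevelwiseClosed {d : ℕ} (S : FreeSet d) : Prop :=
  ∀ n : ℕ, 0 < n → IsClosed (S n)

/-- Every level is bounded (in the operator norm). -/
def IsLevelwiseBounded {d : ℕ} (S : FreeSet d) : Prop :=
  ∀ n : ℕ, 0 < n → Bornology.IsBounded (S n)

end CStar

/-- A point `z ∈ ℂᵈ` as a `d`-tuple of `1 × 1` matrices. -/
def pointTuple {d : ℕ} (z : Fin d → ℂ) : MatTuple d 1 :=
  fun j => Matrix.of fun _ _ => z j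

/-- The first level `S₁`, as a subset of `ℂᵈ`. -/
def firstLevel {d : ℕ} (S : FreeSet d) : Set (Fin d → ℂ) :=
  {z | pointTuple z ∈ S 1}

/-- `X = ∑ᵢ Vᵢ* Aᵢ Vᵢ` is a weakly proper matrix convex combination of the points `Aᵢ ∈ S`,
of sizes `size i`. -/
def IsWeaklyProperCombination {d n : ℕ} (S : FreeSet d) (X : MatTuple d n) {k : ℕ}
    (size : Fin k → ℕ) (A : (i : Fin k) → MatTuple d (size i))
    (V : (i : Fin k) → Matrix (Fin (size i)) (Fin n) ℂ) : Prop :=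
  (∀ i, 0 < size i ∧ A i ∈ S (size i)) ∧
  (∀ i, V i ≠ 0) ∧
  ∑ i, (V i).conjTranspose * V i = 1 ∧
  X = ∑ i, conjBy (V i) (A i)

/-- `X`, of size `n ≥ 1`, is an absolute extreme point of `S`. -/
def IsAbsoluteExtremePoint {d n : ℕ} (S : FreeSet d) (X : MatTuple d n) : Prop :=
  0 < n ∧ X ∈ S n ∧
  ∀ (k : ℕ) (size : Fin k → ℕ) (A : (i : Fin k) → MatTuple d (size i))
    (V : (i : Fin k) → Matrix (Fin (size i)) (Fin n) ℂ),
    IsWeaklyProperCombination S X size A V →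
    ∀ i, UnitarilyEquivalent X (A i) ∨
      ∃ (p : ℕ) (Z : MatTuple d p), 0 < p ∧ Z ∈ S p ∧ UnitarilyEquivalent (directSum X Z) (A i)

/-- A polytope in `ℂᵈ ≅ ℝ²ᵈ`: the real convex hull of finitely many points. -/
def IsPolytope {d : ℕ} (P : Set (Fin d → ℂ)) : Prop :=
  ∃ F : Finset (Fin d → ℂ), P = convexHull ℝ (F : Set (Fin d → ℂ))

/-- `z` is an isolated extreme point of `K`: an extreme point of `K` that is isolated in the set
of extreme points of `K`. -/
def IsIsolatedExtremePoint {d : ℕ} (K : Set (Fin d → ℂ)) (z : Fin d → ℂ) : Prop :=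
  z ∈ K.extremePoints ℝ ∧
    ∃ U : Set (Fin d → ℂ), IsOpen U ∧ U ∩ K.extremePoints ℝ = {z}

end MatrixConvexity

/-! Both hypotheses place `K` in a closed pointed cone with apex `z`: some real functional `f` and
`ε > 0` satisfy `ε‖x - z‖ ≤ f (x - z)` on `K` (`InPointedCone`). This comes from strictly separating
`z` from a compact set which together with `z` generates the polytope or `K`.

Compressing `A ∈ S n` to a unit vector lands in `K`, so the vectors `u* (A - z) u` all lie in the
cone translated to the origin (`le_shiftedForm`). If `z = ∑ Vᵢ* Aᵢ Vᵢ` is weakly proper, the cone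
elements `Vᵢ* (Aᵢ - z) Vᵢ` sum to zero, so each vanishes. The form of `Aᵢ` therefore reaches the
apex at `Vᵢ`. Perturbing `Vᵢ` to first order in any direction must stay in a cone that contains no
line, so the linear term is zero. Hence `Vᵢ` spans a reducing subspace on which `Aᵢ` acts as `z`
(`reducing_of_shiftedForm_eq_zero`). The complementary compression is the summand `Z`, in `S` by
matrix convexity. -/

namespace MatrixConvexity

/-! ### Pointed cones at vertices and at isolated extreme points -/

section ConvexGeometry

variable {E : Type*} [NormedAddCommGroup E] [NormedSpace ℝ E]

/-- The convex hull of a compact set in a finite-dimensional space is compact. -/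
theorem isCompact_convexHull_of_finiteDimensional [FiniteDimensional ℝ E] {T : Set E}
    (hT : IsCompact T) : IsCompact (convexHull ℝ T) := by
  rcases T.eq_empty_or_nonempty with rfl | ⟨t₀, ht₀⟩
  · simp
  -- Carathéodory: `N` points suffice, so the hull is a continuous image of a simplex times `T ^ N`.
  set N := Module.finrank ℝ E + 1
  have hc : IsCompact ((fun p : (Fin N → ℝ) × (Fin N → E) => ∑ i, p.1 i • p.2 i) ''
      (stdSimplex ℝ (Fin N) ×ˢ Set.univ.pi fun _ => T)) :=
    ((isCompact_stdSimplex ℝ (Fin N)).prod (isCompact_univ_pi fun _ => hT)).image (by fun_prop)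
  convert hc using 1
  apply Set.Subset.antisymm
  · intro x hx
    obtain ⟨ι, _, y, w, hy, hind, hw, hw1, rfl⟩ := eq_pos_convex_span_of_mem_convexHull hx
    have hcard : Fintype.card ι ≤ Fintype.card (Fin N) := by
      rw [Fintype.card_fin]
      exact hind.card_le_finrank_succ.trans (by
        have := Submodule.finrank_le (vectorSpan ℝ (Set.range y))
        omega)
    obtain ⟨e⟩ := Function.Embedding.nonempty_of_card_le hcard
    -- Fewer than `N` points are padded by copies of `t₀` with weight zero.
    refine ⟨(Function.extend e w 0, Function.extend e y fun _ => t₀), ⟨⟨?_, ?_⟩, ?_⟩, ?_⟩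
    · intro i
      by_cases h : ∃ j, e j = i
      · obtain ⟨j, rfl⟩ := h
        simpa only [e.injective.extend_apply] using (hw j).le
      · simp only [Function.extend_apply' _ _ _ h, Pi.zero_apply, le_refl]
    · rw [← hw1]
      refine (Fintype.sum_of_injective e e.injective _ _ (fun i hi => ?_) fun j => ?_).symm
      · exact Function.extend_apply' _ _ _ hi
      · exact (e.injective.extend_apply _ _ _).symm
    · intro i _
      by_cases h : ∃ j, e j = i
      · obtain ⟨j, rfl⟩ := h
        simpa only [e.injective.extend_apply] using hy (Set.mem_range_self j)
      · simpa only [Function.extend_apply' _ _ _ h] using ht₀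
    · refine (Fintype.sum_of_injective e e.injective _ _ (fun i hi => ?_) fun j => ?_).symm
      · simp only [Function.extend_apply' _ _ _ hi, Pi.zero_apply, zero_smul]
      · simp only [e.injective.extend_apply]
  · rintro _ ⟨⟨w, y⟩, ⟨hw, hy⟩, rfl⟩
    exact (convex_convexHull ℝ T).sum_mem (fun i _ => hw.1 i) hw.2
      fun i _ => subset_convexHull ℝ T (hy i (Set.mem_univ i))

/-- `K` lies in a closed pointed cone with apex `z`, given by a linear functional. -/
def InPointedCone (K : Set E) (z : E) : Prop :=
  ∃ (f : E →L[ℝ] ℝ) (ε : ℝ), 0 < ε ∧ ∀ x ∈ K, ε * ‖x - z‖ ≤ f (x - z)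

theorem InPointedCone.mono {K L : Set E} {z : E} (h : InPointedCone L z) (hKL : K ⊆ L) :
    InPointedCone K z := by
  obtain ⟨f, ε, hε, hf⟩ := h
  exact ⟨f, ε, hε, fun x hx => hf x (hKL hx)⟩

/-- If `z` is not in the convex hull of the compact set `T`, then the closed convex hull of
`{z} ∪ T` lies in a closed pointed cone with apex `z`. -/
theorem inPointedCone_closure_convexHull_insert [FiniteDimensional ℝ E] {T : Set E}
    (hT : IsCompact T) {z : E} (hz : z ∉ convexHull ℝ T) :
    InPointedCone (closure (convexHull ℝ (insert z T))) z := by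
  obtain ⟨f, u, hfz, hfT⟩ := geometric_hahn_banach_point_closed (convex_convexHull ℝ T)
    (isCompact_convexHull_of_finiteDimensional hT).isClosed hz
  obtain ⟨M, hM⟩ := hT.isBounded.subset_closedBall z
  have hM' : 0 < |M| + 1 := by positivity
  -- On `T`, `f` exceeds `f z` by at least `u - f z`, while the distance to `z` is at most `|M| +
  -- 1`; the `+ 1` keeps the denominator positive.
  set ε := (u - f z) / (|M| + 1)
  have hε : 0 < ε := div_pos (sub_pos.2 hfz) hM'
  refine ⟨f, ε, hε, ?_⟩
  -- The cone is convex and closed, so only `z` and the points of `T` need checking.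
  have hconv : Convex ℝ {x | ε * ‖x - z‖ ≤ f (x - z)} := by
    intro x hx y hy a b ha hb hab
    have e : a • x + b • y - z = a • (x - z) + b • (y - z) := by
      have : z = (a + b) • z := by rw [hab, one_smul]
      nth_rewrite 1 [this]
      module
    simp only [Set.mem_ofPred_eq] at hx hy ⊢
    rw [e, map_add, map_smul, map_smul, smul_eq_mul, smul_eq_mul]
    calc ε * ‖a • (x - z) + b • (y - z)‖ ≤ ε * (a * ‖x - z‖ + b * ‖y - z‖) := by
          gcongr
          refine (norm_add_le _ _).trans ?_
          rw [norm_smul, norm_smul, Real.norm_of_nonneg ha, Real.norm_of_nonneg hb]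
      _ = a * (ε * ‖x - z‖) + b * (ε * ‖y - z‖) := by ring
      _ ≤ _ := by gcongr
  have hcl : IsClosed {x | ε * ‖x - z‖ ≤ f (x - z)} :=
    isClosed_le (by fun_prop) (by fun_prop)
  refine fun x hx => closure_minimal (convexHull_min (Set.insert_subset ?_ ?_) hconv) hcl hx
  · simp
  · intro y hy
    have h1 := hfT y (subset_convexHull ℝ T hy)
    have h2 : ‖y - z‖ ≤ |M| + 1 := by
      have := hM hy
      rw [mem_closedBall_iff_norm] at this
      linarith [le_abs_self M]
    calc ε * ‖y - z‖ ≤ ε * (|M| + 1) := by gcongr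
      _ = u - f z := div_mul_cancel₀ _ hM'.ne'
      _ ≤ f (y - z) := by rw [map_sub]; linarith

/-- A polytope lies in a closed pointed cone with apex any of its vertices. -/
theorem inPointedCone_of_mem_extremePoints_convexHull [FiniteDimensional ℝ E] {F : Set E}
    (hF : F.Finite) {z : E} (hz : z ∈ (convexHull ℝ F).extremePoints ℝ) :
    InPointedCone (convexHull ℝ F) z := by
  have hconv := ((convex_convexHull ℝ F).mem_extremePoints_iff_convex_sdiff.1 hz).2
  -- Removing an extreme point leaves a convex set, which thus contains the hull of the remaining
  -- generators.
  have hz' : z ∉ convexHull ℝ (F \ {z}) := fun h =>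
    (convexHull_min (Set.sdiff_subset_sdiff_left (subset_convexHull ℝ F)) hconv h).2 rfl
  refine (inPointedCone_closure_convexHull_insert hF.sdiff.isCompact hz').mono ?_
  refine (convexHull_mono ?_).trans subset_closure
  rw [Set.insert_sdiff_singleton]
  exact Set.subset_insert z F

/-- A compact convex set lies in a closed pointed cone with apex any of its isolated extreme
points. -/
theorem inPointedCone_of_isolated [FiniteDimensional ℝ E] {K U : Set E} (hK : IsCompact K)
    (hconv : Convex ℝ K) {z : E} (hz : z ∈ K.extremePoints ℝ) (hU : IsOpen U)
    (hUz : U ∩ K.extremePoints ℝ = {z}) : InPointedCone K z := by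
  have hzU : z ∈ U := (hUz.symm ▸ Set.mem_singleton z : z ∈ U ∩ K.extremePoints ℝ).1
  -- The extreme points need not form a closed set; the closure makes `T` compact, and removing `U`
  -- keeps `z` out of it.
  set T := K \ U ∩ closure (K.extremePoints ℝ)
  have hT : IsCompact T := (hK.diff hU).inter_right isClosed_closure
  have hconv' := (hconv.mem_extremePoints_iff_convex_sdiff.1 hz).2
  have hTK : T ⊆ K \ {z} := fun x hx => ⟨hx.1.1, fun h => hx.1.2 (h ▸ hzU)⟩
  have hz' : z ∉ convexHull ℝ T := fun h => (convexHull_min hTK hconv' h).2 rfl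
  refine (inPointedCone_closure_convexHull_insert hT hz').mono ?_
  -- Krein–Milman: every extreme point is `z` or lies in `T`.
  nth_rewrite 1 [← closure_convexHull_extremePoints hK hconv]
  refine closure_mono (convexHull_mono fun x hx => ?_)
  by_cases hxU : x ∈ U
  · exact Or.inl (hUz ▸ (⟨hxU, hx⟩ : x ∈ U ∩ K.extremePoints ℝ) : x ∈ ({z} : Set E))
  · exact Or.inr ⟨⟨hx.1, hxU⟩, subset_closure hx⟩

/-- If `t L + t² Q` lies in a closed pointed cone for all real `t`, then `L = 0`. -/
theorem eq_zero_of_forall_quadratic_mem_cone {f : E →L[ℝ] ℝ} {ε : ℝ} (hε : 0 < ε) {L Q : E}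
    (h : ∀ t : ℝ, ε * ‖t • L + t ^ 2 • Q‖ ≤ f (t • L + t ^ 2 • Q)) : L = 0 := by
  -- Adding the inequalities at `t` and `-t` cancels `f L`; the triangle inequality keeps `2t‖L‖` on
  -- the left. Then let `t → 0⁺`.
  have key : ∀ t : ℝ, 0 < t → ε * ‖L‖ ≤ t * f Q := by
    intro t ht
    have h1 := h t
    have h2 := h (-t)
    have h3 : (2 * t) * ‖L‖ ≤ ‖t • L + t ^ 2 • Q‖ + ‖-t • L + (-t) ^ 2 • Q‖ := by
      have e : (2 * t) • L = (t • L + t ^ 2 • Q) - (-t • L + (-t) ^ 2 • Q) := by module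
      have := norm_sub_le (t • L + t ^ 2 • Q) (-t • L + (-t) ^ 2 • Q)
      rwa [← e, norm_smul, Real.norm_of_nonneg (by positivity)] at this
    simp only [map_add, map_smul, smul_eq_mul] at h1 h2
    have h4 := mul_le_mul_of_nonneg_left h3 hε.le
    have h5 : (2 * t) * (ε * ‖L‖) ≤ (2 * t) * (t * f Q) := by nlinarith
    exact le_of_mul_le_mul_left h5 (by positivity)
  have h0 : ε * ‖L‖ ≤ 0 := by
    have ht : Filter.Tendsto (fun t : ℝ => t * f Q) (nhdsWithin 0 (Set.Ioi 0)) (nhds 0) := by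
      have : Filter.Tendsto (fun t : ℝ => t * f Q) (nhds 0) (nhds (0 * f Q)) :=
        (continuous_id.mul continuous_const).tendsto 0
      rw [zero_mul] at this
      exact this.mono_left nhdsWithin_le_nhds
    exact ge_of_tendsto ht (Filter.eventually_of_mem self_mem_nhdsWithin key)
  exact norm_le_zero_iff.1 (nonpos_of_mul_nonpos_right h0 hε)

end ConvexGeometry

/-! ### Compressions as completely positive maps; compactness of the first level -/

section Compression

open scoped Matrix.Norms.L2Operator MatrixOrder CStarAlgebra

/-- The linear map `T ↦ V* T V`. -/
noncomputable def conjLinearMap {n m : ℕ} (V : Matrix (Fin n) (Fin m) ℂ) :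
    Matrix (Fin n) (Fin n) ℂ →ₗ[ℂ] Matrix (Fin m) (Fin m) ℂ where
  toFun T := V.conjTranspose * T * V
  map_add' A B := by rw [Matrix.mul_add, Matrix.add_mul]
  map_smul' c A := by simp

@[simp]
theorem conjLinearMap_apply {n m : ℕ} (V : Matrix (Fin n) (Fin m) ℂ)
    (T : Matrix (Fin n) (Fin n) ℂ) : conjLinearMap V T = V.conjTranspose * T * V :=
  rfl

theorem cstarMatrix_sum_apply {ι m n A : Type*} [AddCommMonoid A] (s : Finset ι)
    (C : ι → CStarMatrix m n A) (i : m) (j : n) : (∑ r ∈ s, C r) i j = ∑ r ∈ s, C r i j := by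
  classical
  induction s using Finset.induction_on with
  | empty => rfl
  | insert a s ha ih => rw [Finset.sum_insert ha, Finset.sum_insert ha, CStarMatrix.add_apply, ih]

/-- Entrywise application of `T ↦ V* T V` to a square is a sum of squares. -/
theorem star_mul_self_map_conjLinearMap {n m k : ℕ} (i₀ : Fin m) (V : Matrix (Fin n) (Fin m) ℂ)
    (N : CStarMatrix (Fin k) (Fin k) (Matrix (Fin n) (Fin n) ℂ)) :
    (star N * N).map (conjLinearMap V) =
      ∑ r, star (N.map fun T => (Matrix.single i₀ r (1 : ℂ) * T : Matrix (Fin m) (Fin n) ℂ) * V) *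
        N.map fun T => (Matrix.single i₀ r (1 : ℂ) * T : Matrix (Fin m) (Fin n) ℂ) * V := by
  -- `T * V` is not square, so it is cut into its rows, each placed in row `i₀` of a square matrix.
  -- This identity reassembles them.
  have hsum : ∑ r, (Matrix.single i₀ r (1 : ℂ)).conjTranspose *
      Matrix.single i₀ r (1 : ℂ) = (1 : Matrix (Fin n) (Fin n) ℂ) := by
    simp [Matrix.conjTranspose_single, Matrix.sum_single_eq_diagonal]
  set C : Fin n → CStarMatrix (Fin k) (Fin k) (Matrix (Fin m) (Fin m) ℂ) := fun r =>
    N.map fun T => (Matrix.single i₀ r (1 : ℂ) * T : Matrix (Fin m) (Fin n) ℂ) * V with hC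
  change _ = ∑ r, star (C r) * C r
  refine CStarMatrix.ext fun i j => ?_
  have hterm : ∀ (r : Fin n) (l : Fin k), (star (C r) : CStarMatrix _ _ _) i l * C r l j =
      V.conjTranspose * (N l i).conjTranspose *
        ((Matrix.single i₀ r (1 : ℂ)).conjTranspose *
          Matrix.single i₀ r (1 : ℂ)) * (N l j * V) := by
    intro r l
    simp only [hC, CStarMatrix.star_apply, CStarMatrix.map_apply, Matrix.star_eq_conjTranspose,
      Matrix.conjTranspose_mul, Matrix.mul_assoc]
  rw [cstarMatrix_sum_apply]
  simp only [CStarMatrix.mul_apply, CStarMatrix.map_apply, hterm]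
  rw [Finset.sum_comm]
  simp only [← Matrix.sum_mul, ← Matrix.mul_sum, hsum, Matrix.mul_one]
  simp only [map_sum, conjLinearMap_apply, CStarMatrix.star_apply,
    Matrix.star_eq_conjTranspose, Matrix.mul_assoc]

/-- The completely positive map `T ↦ V* T V`. -/
noncomputable def compression {n m : ℕ} (hm : 0 < m) (V : Matrix (Fin n) (Fin m) ℂ) :
    Matrix (Fin n) (Fin n) ℂ →CP Matrix (Fin m) (Fin m) ℂ where
  toLinearMap := conjLinearMap V
  map_cstarMatrix_nonneg' k M hM := by
    -- Nonnegative elements are generated by the squares `star N * N`, and the map is additive.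
    rw [StarOrderedRing.nonneg_iff] at hM
    induction hM using AddSubmonoid.closure_induction with
    | mem x hx =>
      obtain ⟨N, rfl⟩ := hx
      dsimp only
      rw [star_mul_self_map_conjLinearMap ⟨0, hm⟩ V N]
      exact Finset.sum_nonneg fun r _ => star_mul_self_nonneg _
    | zero =>
      have h : (0 : CStarMatrix (Fin k) (Fin k) (Matrix (Fin n) (Fin n) ℂ)).map
          (conjLinearMap V) = 0 := CStarMatrix.ext fun i j => map_zero (conjLinearMap V)
      rw [h]
    | add x y _ _ hx hy =>
      have h : (x + y).map (conjLinearMap V) = x.map (conjLinearMap V) + y.map (conjLinearMap V) :=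
        CStarMatrix.ext fun i j => map_add (conjLinearMap V) _ _
      rw [h]
      exact add_nonneg hx hy

variable {d : ℕ} {S : FreeSet d}

theorem IsMatrixConvex.conjBy_mem (hS : IsMatrixConvex S) {n m : ℕ} (hn : 0 < n) (hm : 0 < m)
    {X : MatTuple d n} (hX : X ∈ S n) {V : Matrix (Fin n) (Fin m) ℂ}
    (hV : V.conjTranspose * V = 1) : conjBy V X ∈ S m :=
  hS.2 n m hn hm (compression hm V)
    (show V.conjTranspose * (1 : Matrix (Fin n) (Fin n) ℂ) * V = 1 by rw [Matrix.mul_one, hV]) X hX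

theorem pointTuple_apply_zero {X : MatTuple d 1} : pointTuple (fun j => X j 0 0) = X := by
  funext j
  ext a b
  rw [Subsingleton.elim a 0, Subsingleton.elim b 0]
  rfl

theorem isCompact_firstLevel (hclosed : IsLevelwiseClosed S) (hbounded : IsLevelwiseBounded S) :
    IsCompact (firstLevel S) := by
  have h1 : IsCompact (S 1) :=
    Metric.isCompact_of_isClosed_isBounded (hclosed 1 one_pos) (hbounded 1 one_pos)
  have h2 : firstLevel S = (fun (X : MatTuple d 1) j => X j 0 0) '' S 1 := by
    ext z
    constructor
    · exact fun hz => ⟨_, hz, rfl⟩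
    · rintro ⟨X, hX, rfl⟩
      exact (congrArg (· ∈ S 1) pointTuple_apply_zero).mpr hX
  rw [h2]
  exact h1.image (by fun_prop)

end Compression

/-! ### Convexity of the first level -/

section FirstLevel

variable {d : ℕ} {S : FreeSet d}

theorem convex_firstLevel (hS : IsMatrixConvex S) : Convex ℝ (firstLevel S) := by
  intro z hz w hw a b ha hb hab
  -- The isometry `(√a, √b)ᵀ` compresses `z ⊕ w` to `a z + b w`.
  set V : Matrix (Fin (1 + 1)) (Fin 1) ℂ := Matrix.of fun i _ =>
    Fin.append (fun _ : Fin 1 => ((√a : ℝ) : ℂ)) (fun _ : Fin 1 => ((√b : ℝ) : ℂ)) i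
  have ha' : ((√a : ℝ) : ℂ) * ((√a : ℝ) : ℂ) = a := by
    rw [← Complex.ofReal_mul, Real.mul_self_sqrt ha]
  have hb' : ((√b : ℝ) : ℂ) * ((√b : ℝ) : ℂ) = b := by
    rw [← Complex.ofReal_mul, Real.mul_self_sqrt hb]
  have hV : V.conjTranspose * V = 1 := by
    ext i j
    rw [Subsingleton.elim i 0, Subsingleton.elim j 0]
    simp only [V, Matrix.mul_apply, Fin.sum_univ_add, Matrix.conjTranspose_apply, Matrix.of_apply,
      Fin.append_left, Fin.append_right, Complex.star_def, Complex.conj_ofReal,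
      Finset.univ_unique, Finset.sum_singleton, ha', hb', Matrix.one_apply_eq]
    exact_mod_cast hab
  have h := hS.conjBy_mem (by norm_num) one_pos (hS.1 1 1 one_pos one_pos _ hz _ hw) hV
  have e : conjBy V (directSum (pointTuple z) (pointTuple w)) = pointTuple (a • z + b • w) := by
    rw [← pointTuple_apply_zero (X := conjBy V _)]
    congr 1
    funext j
    simp only [V, conjBy, directSum, pointTuple, Matrix.mul_apply, Fin.sum_univ_add,
      Matrix.conjTranspose_apply, Matrix.of_apply,
      Fin.append_left, Fin.append_right, Complex.star_def, Complex.conj_ofReal,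
      Finset.univ_unique, Finset.sum_singleton, Matrix.reindex_apply, Matrix.submatrix_apply,
      finSumFinEquiv_symm_apply_castAdd, finSumFinEquiv_symm_apply_natAdd,
      Matrix.fromBlocks_apply₁₁, Matrix.fromBlocks_apply₁₂, Matrix.fromBlocks_apply₂₁,
      Matrix.fromBlocks_apply₂₂, Matrix.zero_apply, mul_zero, add_zero, zero_add,
      Pi.add_apply, Pi.smul_apply, Complex.real_smul]
    linear_combination z j * ha' + w j * hb'
  exact (congrArg (· ∈ S 1) e).mp h

end FirstLevel

/-! ### The form of `A - z` and its zeros -/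

section Form

variable {d n : ℕ}

/-- The sesquilinear form `(u, w) ↦ (u* (Aⱼ - zⱼ) w)ⱼ`, with values in `ℂᵈ`. -/
noncomputable def shiftedForm (A : MatTuple d n) (z : Fin d → ℂ) (u w : Matrix (Fin n) (Fin 1) ℂ) :
    Fin d → ℂ :=
  fun j =>
    (u.conjTranspose * (A j - z j • (1 : Matrix (Fin n) (Fin n) ℂ)) * w : Matrix (Fin 1) (Fin 1) ℂ) 0 0

theorem shiftedForm_eq (A : MatTuple d n) (z : Fin d → ℂ) (u w : Matrix (Fin n) (Fin 1) ℂ) :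
    shiftedForm A z u w = fun j =>
      (u.conjTranspose * A j * w) 0 0 - z j * (u.conjTranspose * w) 0 0 := by
  funext j
  simp [shiftedForm, Matrix.mul_sub, Matrix.sub_mul]

/-- The squared Euclidean norm of a column. -/
noncomputable def colNormSq (u : Matrix (Fin n) (Fin 1) ℂ) : ℝ := ∑ i, ‖u i 0‖ ^ 2

theorem conjTranspose_mul_self_eq (u : Matrix (Fin n) (Fin 1) ℂ) :
    u.conjTranspose * u = (colNormSq u : ℂ) • (1 : Matrix (Fin 1) (Fin 1) ℂ) := by
  ext i j
  rw [Subsingleton.elim i 0, Subsingleton.elim j 0]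
  simp [colNormSq, Matrix.mul_apply, Complex.conj_mul']

theorem colNormSq_pos {u : Matrix (Fin n) (Fin 1) ℂ} (hu : u ≠ 0) : 0 < colNormSq u := by
  obtain ⟨i, hi⟩ : ∃ i, u i 0 ≠ 0 := by
    by_contra! h
    exact hu (by ext i j; rw [Subsingleton.elim j 0, h i]; rfl)
  exact Finset.sum_pos' (fun _ _ => by positivity) ⟨i, Finset.mem_univ i, by positivity⟩

/-- The unit column in the direction of `u`. -/
noncomputable def normalizedCol (u : Matrix (Fin n) (Fin 1) ℂ) : Matrix (Fin n) (Fin 1) ℂ :=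
  (((√(colNormSq u))⁻¹ : ℝ) : ℂ) • u

theorem conjTranspose_normalizedCol_mul (u : Matrix (Fin n) (Fin 1) ℂ) (hu : u ≠ 0)
    (T : Matrix (Fin n) (Fin n) ℂ) :
    (normalizedCol u).conjTranspose * T * normalizedCol u =
      (((colNormSq u)⁻¹ : ℝ) : ℂ) • (u.conjTranspose * T * u) := by
  have h : (((√(colNormSq u))⁻¹ : ℝ) : ℂ) * (((√(colNormSq u))⁻¹ : ℝ) : ℂ) =
      (((colNormSq u)⁻¹ : ℝ) : ℂ) := by
    rw [← Complex.ofReal_mul, ← mul_inv, Real.mul_self_sqrt (colNormSq_pos hu).le]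
  rw [normalizedCol, Matrix.conjTranspose_smul, Complex.star_def, Complex.conj_ofReal,
    Matrix.smul_mul, Matrix.smul_mul, Matrix.mul_smul, smul_smul, h]

theorem normalizedCol_isometry {u : Matrix (Fin n) (Fin 1) ℂ} (hu : u ≠ 0) :
    (normalizedCol u).conjTranspose * normalizedCol u = 1 := by
  have h := conjTranspose_normalizedCol_mul u hu 1
  rw [Matrix.mul_one, Matrix.mul_one, conjTranspose_mul_self_eq u, smul_smul, ← Complex.ofReal_mul,
    inv_mul_cancel₀ (colNormSq_pos hu).ne', Complex.ofReal_one, one_smul] at h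
  exact h

variable {S : FreeSet d} {f : (Fin d → ℂ) →L[ℝ] ℝ} {ε : ℝ} {z : Fin d → ℂ}

/-- For `u ≠ 0` the value is `‖u‖²` times `x - z`, with `x` the compression of `A` to the direction
of `u`; the cone inequality is positively homogeneous. -/
theorem le_shiftedForm (hS : IsMatrixConvex S) (hn : 0 < n) {A : MatTuple d n} (hA : A ∈ S n)
    (hf : ∀ x ∈ firstLevel S, ε * ‖x - z‖ ≤ f (x - z)) (u : Matrix (Fin n) (Fin 1) ℂ) :
    ε * ‖shiftedForm A z u u‖ ≤ f (shiftedForm A z u u) := by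
  by_cases hu : u = 0
  · have : shiftedForm A z u u = 0 := by
      funext j
      simp [shiftedForm, hu]
    simp [this]
  · have hpos := colNormSq_pos hu
    have hmem : (fun j => (conjBy (normalizedCol u) A) j 0 0) ∈ firstLevel S := by
      rw [firstLevel, Set.mem_ofPred_eq, pointTuple_apply_zero]
      exact hS.conjBy_mem hn one_pos hA (normalizedCol_isometry hu)
    have h := hf _ hmem
    have e : (fun j => (conjBy (normalizedCol u) A) j 0 0) - z =
        (colNormSq u)⁻¹ • shiftedForm A z u u := by
      rw [shiftedForm_eq, conjTranspose_mul_self_eq]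
      funext j
      simp only [conjBy, conjTranspose_normalizedCol_mul u hu, Pi.sub_apply, Pi.smul_apply,
        Matrix.smul_apply, Matrix.one_apply_eq, smul_eq_mul, Complex.real_smul, mul_one]
      have : (colNormSq u : ℂ) ≠ 0 := by exact_mod_cast hpos.ne'
      push_cast
      field_simp
    rw [e, norm_smul, map_smul, smul_eq_mul, Real.norm_of_nonneg (inv_nonneg.2 hpos.le),
      mul_left_comm] at h
    exact le_of_mul_le_mul_left h (inv_pos.2 hpos)

/-- If `shiftedForm A z v v` is the apex of the cone, then `v` spans a reducing subspace on which
each `Aⱼ` is the scalar `zⱼ`. -/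
theorem reducing_of_shiftedForm_eq_zero (hS : IsMatrixConvex S) (hn : 0 < n) {A : MatTuple d n}
    (hA : A ∈ S n) (hε : 0 < ε) (hf : ∀ x ∈ firstLevel S, ε * ‖x - z‖ ≤ f (x - z))
    {v : Matrix (Fin n) (Fin 1) ℂ} (hv : shiftedForm A z v v = 0) (j : Fin d) :
    A j * v = z j • v ∧ v.conjTranspose * A j = z j • v.conjTranspose := by
  have hadd : ∀ w, shiftedForm A z v w + shiftedForm A z w v = 0 := by
    intro w
    refine eq_zero_of_forall_quadratic_mem_cone (f := f) hε (Q := shiftedForm A z w w) fun t => ?_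
    -- The constant term of the expansion at `v + t w` is zero by `hv`.
    have e : t • (shiftedForm A z v w + shiftedForm A z w v) + t ^ 2 • shiftedForm A z w w =
        shiftedForm A z (v + (t : ℂ) • w) (v + (t : ℂ) • w) := by
      rw [← zero_add (_ + _), ← hv]
      funext j
      simp only [shiftedForm, Pi.add_apply, Pi.smul_apply, Matrix.conjTranspose_add,
        Matrix.conjTranspose_smul, Complex.star_def, Complex.conj_ofReal, Matrix.add_mul,
        Matrix.mul_add, Matrix.smul_mul, Matrix.mul_smul, Matrix.add_apply, Matrix.smul_apply,
        smul_eq_mul, Complex.real_smul]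
      push_cast
      ring
    rw [e]
    exact le_shiftedForm hS hn hA hf _
  -- Replacing `w` by `i w` separates the part linear in `w` from the conjugate-linear part.
  have haux : ∀ a b : ℂ, a + b = 0 → Complex.I * a + -Complex.I * b = 0 → a = 0 ∧ b = 0 := by
    intro a b h1 h2
    constructor
    · linear_combination (1 / 2 : ℂ) * h1 - Complex.I / 2 * h2 + (a - b) / 2 * Complex.I_mul_I
    · linear_combination (1 / 2 : ℂ) * h1 + Complex.I / 2 * h2 - (a - b) / 2 * Complex.I_mul_I
  have hboth : ∀ w, shiftedForm A z v w j = 0 ∧ shiftedForm A z w v j = 0 := by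
    intro w
    have h1 := congrFun (hadd w) j
    have h2 := congrFun (hadd (Complex.I • w)) j
    simp only [shiftedForm, Pi.add_apply, Pi.zero_apply,
      Matrix.conjTranspose_smul, Complex.star_def, Complex.conj_I,
      Matrix.smul_mul, Matrix.mul_smul, Matrix.smul_apply, smul_eq_mul] at h1 h2 ⊢
    exact haux _ _ h1 h2
  constructor
  · have h : (A j - z j • 1) * v = 0 := by
      ext i k
      have := (hboth (Matrix.single i 0 1)).2
      rw [Subsingleton.elim k 0]
      simpa [shiftedForm, Matrix.conjTranspose_single, Matrix.mul_assoc] using this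
    rwa [Matrix.sub_mul, Matrix.smul_mul, Matrix.one_mul, sub_eq_zero] at h
  · have h : v.conjTranspose * (A j - z j • 1) = 0 := by
      ext k i
      have := (hboth (Matrix.single i 0 1)).1
      rw [Subsingleton.elim k 0]
      simpa [shiftedForm] using this
    rwa [Matrix.mul_sub, Matrix.mul_smul, Matrix.mul_one, sub_eq_zero] at h

end Form

/-! ### Splitting off a scalar direct summand -/

section Splitting

variable {d : ℕ}

/-- A unit column is the first column of a unitary matrix. -/
theorem exists_unitary_extension {p : ℕ} {v : Matrix (Fin (1 + p)) (Fin 1) ℂ}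
    (hv : v.conjTranspose * v = 1) :
    ∃ M : Matrix (Fin (1 + p)) (Fin (1 + p)) ℂ, M.conjTranspose * M = 1 ∧
      M.submatrix id (Fin.castAdd p) = v := by
  set x : EuclideanSpace ℂ (Fin (1 + p)) := WithLp.toLp 2 fun i => v i 0
  -- Only the index of the first column is prescribed; the constant family is a dummy elsewhere.
  have hx : Orthonormal ℂ (Set.domRestrict {Fin.castAdd p (0 : Fin 1)}
      (fun _ : Fin (1 + p) => x)) := by
    have hx1 : inner ℂ x x = 1 := by
      have := congrFun (congrFun hv 0) 0
      rw [PiLp.inner_apply]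
      simpa [x, Matrix.mul_apply, Complex.mul_conj', mul_comm ((starRingEnd ℂ) _)] using this
    rw [orthonormal_iff_ite]
    rintro ⟨a, rfl⟩ ⟨b, rfl⟩
    simp only [if_true]
    exact hx1
  obtain ⟨b, hb⟩ := hx.exists_orthonormalBasis_extension_of_card_eq (by simp)
  refine ⟨Matrix.of fun i j => b j i, ?_, ?_⟩
  · ext i j
    have := orthonormal_iff_ite.1 b.orthonormal i j
    rw [Matrix.one_apply, ← this]
    simp [PiLp.inner_apply, Matrix.mul_apply, mul_comm]
  · ext i k
    rw [Subsingleton.elim k 0]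
    have := hb _ rfl
    simp [this, x]

theorem unitarilyEquivalent_of_unitary {n : ℕ} (A : MatTuple d n) {M : Matrix (Fin n) (Fin n) ℂ}
    (hM : M.conjTranspose * M = 1) : UnitarilyEquivalent (conjBy M A) A := by
  have hM' : M * M.conjTranspose = 1 := mul_eq_one_comm.1 hM
  refine ⟨M.conjTranspose, by simpa using hM', by simpa using hM, ?_⟩
  funext j
  simp only [conjBy, Matrix.conjTranspose_conjTranspose]
  rw [← Matrix.mul_assoc, ← Matrix.mul_assoc, hM', Matrix.one_mul, Matrix.mul_assoc, hM',
    Matrix.mul_one]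

theorem unitarilyEquivalent_pointTuple {A : MatTuple d 1} {z : Fin d → ℂ}
    {v : Matrix (Fin 1) (Fin 1) ℂ} (hv : v.conjTranspose * v = 1) (hA : ∀ j, A j * v = z j • v) :
    UnitarilyEquivalent (pointTuple z) A := by
  have e : pointTuple z = conjBy v A := by
    funext j
    rw [conjBy, Matrix.mul_assoc, hA j, Matrix.mul_smul, hv]
    ext a b
    rw [Subsingleton.elim a 0, Subsingleton.elim b 0]
    simp [pointTuple]
  rw [e]
  exact unitarilyEquivalent_of_unitary A hv

/-- A tuple which is the scalar `z` on a reducing unit column splits off `z` as a direct summand. -/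
theorem exists_unitarilyEquivalent_directSum {p : ℕ} {A : MatTuple d (1 + p)} {z : Fin d → ℂ}
    {v : Matrix (Fin (1 + p)) (Fin 1) ℂ} (hv : v.conjTranspose * v = 1)
    (hA : ∀ j, A j * v = z j • v ∧ v.conjTranspose * A j = z j • v.conjTranspose) :
    ∃ W : Matrix (Fin (1 + p)) (Fin p) ℂ, W.conjTranspose * W = 1 ∧
      UnitarilyEquivalent (directSum (pointTuple z) (conjBy W A)) A := by
  obtain ⟨M, hM, hMv⟩ := exists_unitary_extension hv
  set W := M.submatrix id (Fin.natAdd 1)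
  -- The columns of the unitary `M = [v | W]` are orthogonal, so the off-diagonal blocks of `M* A M`
  -- vanish.
  have hWv : W.conjTranspose * v = 0 := by
    ext a b
    have := congrFun (congrFun hM (Fin.natAdd 1 a)) (Fin.castAdd p b)
    rw [← hMv]
    rw [Matrix.one_apply_ne (by simp [Fin.ext_iff])] at this
    exact this
  have hvW : v.conjTranspose * W = 0 := by
    have := congrArg Matrix.conjTranspose hWv
    simpa using this
  have e : directSum (pointTuple z) (conjBy W A) = conjBy M A := by
    funext j
    have h11 : v.conjTranspose * A j * v = Matrix.of fun _ _ => z j := by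
      rw [Matrix.mul_assoc, (hA j).1, Matrix.mul_smul, hv]
      ext a b
      rw [Subsingleton.elim a 0, Subsingleton.elim b 0]
      simp
    have h12 : v.conjTranspose * A j * W = 0 := by
      rw [(hA j).2, Matrix.smul_mul, hvW, smul_zero]
    have h21 : W.conjTranspose * A j * v = 0 := by
      rw [Matrix.mul_assoc, (hA j).1, Matrix.mul_smul, hWv, smul_zero]
    rw [← hMv] at h11 h12 h21
    ext a b
    induction a using Fin.addCases with
    | left a =>
      induction b using Fin.addCases with
      | left b =>
        simp only [directSum, pointTuple, Matrix.reindex_apply, Matrix.submatrix_apply,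
          finSumFinEquiv_symm_apply_castAdd, Matrix.fromBlocks_apply₁₁]
        exact (congrFun (congrFun h11 a) b).symm
      | right b =>
        simp only [directSum, pointTuple, Matrix.reindex_apply, Matrix.submatrix_apply,
          finSumFinEquiv_symm_apply_castAdd, finSumFinEquiv_symm_apply_natAdd,
          Matrix.fromBlocks_apply₁₂]
        exact (congrFun (congrFun h12 a) b).symm
    | right a =>
      induction b using Fin.addCases with
      | left b =>
        simp only [directSum, pointTuple, Matrix.reindex_apply, Matrix.submatrix_apply,
          finSumFinEquiv_symm_apply_castAdd, finSumFinEquiv_symm_apply_natAdd,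
          Matrix.fromBlocks_apply₂₁]
        exact (congrFun (congrFun h21 a) b).symm
      | right b =>
        simp only [directSum, Matrix.reindex_apply, Matrix.submatrix_apply,
          finSumFinEquiv_symm_apply_natAdd, Matrix.fromBlocks_apply₂₂]
        rfl
  refine ⟨W, ?_, ?_⟩
  · ext a b
    have := congrFun (congrFun hM (Fin.natAdd 1 a)) (Fin.natAdd 1 b)
    rw [Matrix.one_apply] at this ⊢
    simp only [Fin.natAdd_inj] at this
    exact this
  · rw [e]
    exact unitarilyEquivalent_of_unitary A hM

theorem unitarilyEquivalent_or_directSum {S : FreeSet d} (hS : IsMatrixConvex S) {n : ℕ}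
    (hn : 0 < n) {A : MatTuple d n} (hAS : A ∈ S n) {z : Fin d → ℂ}
    {v : Matrix (Fin n) (Fin 1) ℂ} (hv : v.conjTranspose * v = 1)
    (hA : ∀ j, A j * v = z j • v ∧ v.conjTranspose * A j = z j • v.conjTranspose) :
    UnitarilyEquivalent (pointTuple z) A ∨
      ∃ (p : ℕ) (Z : MatTuple d p), 0 < p ∧ Z ∈ S p ∧
        UnitarilyEquivalent (directSum (pointTuple z) Z) A := by
  obtain ⟨p, rfl⟩ : ∃ p, n = 1 + p := ⟨n - 1, by omega⟩
  -- For `p = 0` nothing is left to split off; this is the first alternative.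
  rcases p.eq_zero_or_pos with rfl | hp
  · exact Or.inl (unitarilyEquivalent_pointTuple hv fun j => (hA j).1)
  · obtain ⟨W, hW, hU⟩ := exists_unitarilyEquivalent_directSum hv hA
    exact Or.inr ⟨p, conjBy W A, hp, hS.conjBy_mem hn hp hAS hW, hU⟩

end Splitting

/-! ### From the cone to absolute extremality -/

/-- A point of the first level which is the apex of a closed pointed cone containing the first
level is an absolute extreme point. -/
theorem isAbsoluteExtremePoint_of_inPointedCone {d : ℕ} {S : FreeSet d} (hS : IsMatrixConvex S)
    {z : Fin d → ℂ} (hz : z ∈ firstLevel S) (hcone : InPointedCone (firstLevel S) z) :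
    IsAbsoluteExtremePoint S (pointTuple z) := by
  obtain ⟨f, ε, hε, hf⟩ := hcone
  refine ⟨one_pos, hz, fun k size A V ⟨hA, hV, hV1, hX⟩ i => ?_⟩
  have hsum : ∑ i, shiftedForm (A i) z (V i) (V i) = 0 := by
    funext j
    have h1 : (∑ i, (V i).conjTranspose * V i) 0 0 = (1 : Matrix (Fin 1) (Fin 1) ℂ) 0 0 := by
      rw [hV1]
    have h2 : z j = (∑ i, conjBy (V i) (A i)) j 0 0 := by
      rw [← hX]
      rfl
    simp only [Finset.sum_apply, Matrix.sum_apply, Matrix.one_apply_eq, conjBy] at h1 h2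
    simp only [shiftedForm_eq, Finset.sum_apply, Finset.sum_sub_distrib, ← Finset.mul_sum, h1,
      ← h2, Pi.zero_apply, mul_one, sub_self]
  have hle : ∀ i, ε * ‖shiftedForm (A i) z (V i) (V i)‖ ≤ f (shiftedForm (A i) z (V i) (V i)) :=
    fun i => le_shiftedForm hS (hA i).1 (hA i).2 hf (V i)
  -- The sum is at most `f` of the total, which is `f 0 = 0`, so every nonnegative term vanishes.
  have hzero : ∑ i, ε * ‖shiftedForm (A i) z (V i) (V i)‖ = 0 := by
    refine le_antisymm ?_ (Finset.sum_nonneg fun i _ => by positivity)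
    refine (Finset.sum_le_sum fun i _ => hle i).trans ?_
    rw [← map_sum, hsum, map_zero]
  have hi : shiftedForm (A i) z (V i) (V i) = 0 := by
    have := (Finset.sum_eq_zero_iff_of_nonneg fun i _ => by positivity).1 hzero i
      (Finset.mem_univ i)
    simpa [hε.ne'] using this
  have hred := reducing_of_shiftedForm_eq_zero hS (hA i).1 (hA i).2 hε hf hi
  have hv := normalizedCol_isometry (hV i)
  have hredv : ∀ j, A i j * normalizedCol (V i) = z j • normalizedCol (V i) ∧
      (normalizedCol (V i)).conjTranspose * A i j = z j • (normalizedCol (V i)).conjTranspose := by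
    intro j
    rw [normalizedCol, Matrix.mul_smul, (hred j).1, Matrix.conjTranspose_smul, Matrix.smul_mul,
      (hred j).2]
    exact ⟨smul_comm _ _ _, smul_comm _ _ _⟩
  exact unitarilyEquivalent_or_directSum hS (hA i).1 (hA i).2 hv hredv

end MatrixConvexity

open MatrixConvexity in
theorem proposition2p1 {d : ℕ} (S : FreeSet d) (hS : IsMatrixConvex S)
    (hclosed : IsLevelwiseClosed S) (hbounded : IsLevelwiseBounded S)
    (K : Set (Fin d → ℂ)) (hK : firstLevel S = K) :
    (∀ z ∈ K, (∃ P : Set (Fin d → ℂ), IsPolytope P ∧ K ⊆ P ∧ z ∈ P.extremePoints ℝ) →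
      IsAbsoluteExtremePoint S (pointTuple z)) ∧
    (∀ z : Fin d → ℂ, IsIsolatedExtremePoint K z →
      IsAbsoluteExtremePoint S (pointTuple z)) := by
  subst hK
  constructor
  · rintro z hz ⟨_, ⟨F, rfl⟩, hKP, hzP⟩
    exact isAbsoluteExtremePoint_of_inPointedCone hS hz
      ((inPointedCone_of_mem_extremePoints_convexHull F.finite_toSet hzP).mono hKP)
  · rintro z ⟨hz, U, hU, hUz⟩
    exact isAbsoluteExtremePoint_of_inPointedCone hS hz.1
      (inPointedCone_of_isolated (isCompact_firstLevel hclosed hbounded) (convex_firstLevel hS)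
        hz hU hUz)
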